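/- Let $(X',m')$ be a probability space and $T':X'\to X'$ a measurable map preserving $m'$. Let $(X,m)$ be a standard probability space (a standard Borel space with a Borel probability measure), $T:X\to X$ an ergodic $m$-preserving measurable map, and $\pi:X'\to X$ a measurable map all of whose fibres $\pi^{-1}(x)$, $x\in X$, are countable (finite or empty fibres allowed), with $\pi_*(m')=m$ and $T\circ\pi=\pi\circ T'$. Let $f:X\to\mathbb R$ be $m$-almost everywhere equal to a measurable function. For a measure-preserving map $S$ of a probability space $(Y,\mu)$ and $h:Y\to\mathbb R$, say that $h$ is a coboundary for $S$ if there is a measurable $g:Y\to\mathbb R$ with $h=g-g\circ S$ $\mu$-almost everywhere; that $h$ is periodic for $S$ if there are $\rho\in\mathbb R$, a measurable $g:Y\to\mathbb R$, $\lambda>0$ and $q:Y\to\mathbb Z$ with $h=\rho+g-g\circ S+\lambda q$ $\mu$-almost everywhere; and that $h$ is aperiodic for $S$ if it is not periodic for $S$. Then: 1. $f$ is a coboundary for $T$ if and only if $f\circ\pi$ is a coboundary for $T'$. 2. If $f\circ\pi$ is aperiodic for $T'$, then $f$ is aperiodic for $T$. Conversely, provided that $X'$ is also a standard Borel space, if $f$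 is aperiodic for $T$, then $f\circ\pi$ is aperiodic for $T'$. In particular, when $X'$ is standard, $f$ is aperiodic for $T$ if and only if $f\circ\pi$ is aperiodic for $T'$. -/

import Mathlib

open MeasureTheory Filter

/-- `f : X → ℝ` is a coboundary for `T` on the measure space `(X, m)`: there is a measurable
real-valued `g` with `f = g - g ∘ T` almost everywhere. -/
def IsErgCoboundary {X : Type*} [MeasurableSpace X] (m : Measure X) (T : X → X)
    (f : X → ℝ) : Prop :=
  ∃ g : X → ℝ, Measurable g ∧ ∀ᵐ x ∂m, f x = g x - g (T x)

/-- `f : X → ℝ` is periodic for `T` on `(X, m)`: almost everywhere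
`f = ρ + g - g ∘ T + l q` with `ρ` a real constant, `g` measurable, `l > 0` and `q`
integer-valued. (If `f` is almost everywhere measurable and `T` preserves `m`, then `q` is
automatically almost everywhere equal to a measurable function.) -/
def IsErgPeriodic {X : Type*} [MeasurableSpace X] (m : Measure X) (T : X → X)
    (f : X → ℝ) : Prop :=
  ∃ (ρ : ℝ) (g : X → ℝ) (l : ℝ) (q : X → ℤ), Measurable g ∧ 0 < l ∧
    ∀ᵐ x ∂m, f x = ρ + g x - g (T x) + l * (q x : ℝ)

/-- `f` is aperiodic if it is not periodic. -/
def IsErgAperiodic {X : Type*} [MeasurableSpace X] (m : Measure X) (T : X → X)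
    (f : X → ℝ) : Prop :=
  ¬ IsErgPeriodic m T f

open ProbabilityTheory Topology ComplexConjugate

/-! Pulling back along `π` gives the easy directions. For the others, disintegrate the law of `(π,
g)` as `m ⊗ₘ κ`, with `g` the transfer function upstairs. The functions `charFun (κ x) s` are
conditional expectations of `exp(isg)`, and `ae_charFun_eq_mul_comp` passes the cohomological
equation on to them. For coboundaries this holds at all rational `s`, so `κ x` is the translate of
`κ (T x)` by `f x`. The medians of `κ x` then form a transfer function; means might not exist, as
`g` need not be integrable. For periodicity it holds only at multiples of `2π / l`, with phase `f -
ρ`. If one of these coefficients is not a.e. zero, its modulus is constant by ergodicity and its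
argument shows `f` periodic. If all vanish, almost every `κ x` is atomless (Wiener), which countable
fibres forbid. -/

/-! ### Conditional characteristic functions over the factor -/

/-- A bounded function fixed by the adjoint of the weighted Koopman isometry `h ↦ c · h ∘ T`
(tested only against itself) is fixed by the isometry. -/
lemma ae_eq_mul_comp_of_integral_conj_eq {X : Type*} [MeasurableSpace X] {m : Measure X}
    [IsProbabilityMeasure m] {T : X → X} (hT : MeasurePreserving T m m) {c h : X → ℂ}
    (hc : Measurable c) (hc1 : ∀ x, ‖c x‖ = 1) (hh : Measurable h) (hh1 : ∀ x, ‖h x‖ ≤ 1)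
    (heq : ∫ x, conj (c x * h (T x)) * h x ∂m = ∫ x, conj (h x) * h x ∂m) :
    ∀ᵐ x ∂m, h x = c x * h (T x) := by
  have hTm := hT.measurable
  have hconj : Measurable (conj : ℂ → ℂ) := Complex.continuous_conj.measurable
  have hw : Measurable fun x => c x * h (T x) := hc.mul (hh.comp hTm)
  have hw1 : ∀ x, ‖c x * h (T x)‖ ≤ 1 := fun x => by rw [norm_mul, hc1, one_mul]; exact hh1 _
  have hint : ∀ u v : X → ℂ, Measurable u → Measurable v → (∀ x, ‖u x‖ ≤ 1) →
      (∀ x, ‖v x‖ ≤ 1) → Integrable (fun x => conj (u x) * v x) m := by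
    intro u v hu hv hu1 hv1
    refine Integrable.of_bound ((hconj.comp hu).mul hv).aestronglyMeasurable 1
      (Eventually.of_forall fun x => ?_)
    rw [norm_mul, RCLike.norm_conj]
    exact mul_le_one₀ (hu1 x) (norm_nonneg _) (hv1 x)
  set w : X → ℂ := fun x => c x * h (T x) with hwdef
  have hww : ∫ x, conj (w x) * w x ∂m = ∫ x, conj (h x) * h x ∂m := by
    have h1 : ∀ x, conj (w x) * w x = (fun y => conj (h y) * h y) (T x) := by
      intro x
      have : conj (c x) * c x = 1 := by rw [← Complex.normSq_eq_conj_mul_self,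
        Complex.normSq_eq_norm_sq, hc1]; simp
      simp only [hwdef, map_mul]
      linear_combination (conj (h (T x)) * h (T x)) * this
    rw [integral_congr_ae (Eventually.of_forall h1)]
    have hsm : AEStronglyMeasurable (fun y => conj (h y) * h y) (m.map T) :=
      ((hconj.comp hh).mul hh).aestronglyMeasurable
    rw [← integral_map hTm.aemeasurable hsm, hT.map_eq]
  have hhw : ∫ x, conj (h x) * w x ∂m = ∫ x, conj (h x) * h x ∂m := by
    have h1 : ∫ x, conj (h x) * w x ∂m = conj (∫ x, conj (w x) * h x ∂m) := by
      rw [← integral_conj]; congr 1; ext x; simp [mul_comm]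
    rw [h1, heq, ← integral_conj]; congr 1; ext x; simp [mul_comm]
  -- Expanding the square gives four inner products, all equal to that of `h` with itself.
  have hzero : ∫ x, ((‖h x - w x‖ ^ 2 : ℝ) : ℂ) ∂m = 0 := by
    have h1 : ∀ x, ((‖h x - w x‖ ^ 2 : ℝ) : ℂ) =
        (conj (h x) * h x - conj (h x) * w x) - (conj (w x) * h x - conj (w x) * w x) := by
      intro x
      rw [← Complex.normSq_eq_norm_sq, Complex.normSq_eq_conj_mul_self, map_sub]; ring
    rw [integral_congr_ae (Eventually.of_forall h1), integral_sub, integral_sub, integral_sub,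
      heq, hhw, hww]
    · simp
    · exact hint _ _ hw hh hw1 hh1
    · exact hint _ _ hw hw hw1 hw1
    · exact hint _ _ hh hh hh1 hh1
    · exact hint _ _ hh hw hh1 hw1
    · exact (hint _ _ hh hh hh1 hh1).sub (hint _ _ hh hw hh1 hw1)
    · exact (hint _ _ hw hh hw1 hh1).sub (hint _ _ hw hw hw1 hw1)
  rw [integral_complex_ofReal, Complex.ofReal_eq_zero, integral_eq_zero_iff_of_nonneg
    (fun x => by positivity)] at hzero
  · filter_upwards [hzero] with x hx
    have : ‖h x - w x‖ = 0 := by simpa using hx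
    exact sub_eq_zero.1 (norm_eq_zero.1 this)
  · refine Integrable.of_bound ((hh.sub hw).norm.pow_const 2).aestronglyMeasurable 4
      (Eventually.of_forall fun x => ?_)
    have h2 : ‖h x - w x‖ ≤ 2 := (norm_sub_le _ _).trans (by linarith [hh1 x, hw1 x])
    rw [Real.norm_of_nonneg (by positivity)]
    nlinarith [norm_nonneg (h x - w x)]

lemma norm_exp_mul_mul_I (s t : ℝ) : ‖Complex.exp (s * t * Complex.I)‖ = 1 := by
  rw [← Complex.ofReal_mul]; exact Complex.norm_exp_ofReal_mul_I _

lemma measurable_exp_mul_mul_I {X : Type*} [MeasurableSpace X] {f : X → ℝ} (hf : Measurable f)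
    (s : ℝ) : Measurable fun x => Complex.exp (s * f x * Complex.I) :=
  ((Complex.measurable_ofReal.comp hf).const_mul _ |>.mul_const _).cexp

lemma measurable_charFun_kernel {X : Type*} [MeasurableSpace X] (κ : Kernel X ℝ)
    [IsMarkovKernel κ] (s : ℝ) : Measurable fun x => charFun (κ x) s := by
  simp_rw [charFun_apply_real]
  exact (StronglyMeasurable.integral_kernel_prod_right' (κ := κ)
    (f := fun p : X × ℝ => Complex.exp (s * p.2 * Complex.I))
    (measurable_exp_mul_mul_I measurable_snd s).stronglyMeasurable).measurable

/-- Integration of characters against a disintegration of the law of `(π, g)`. -/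
lemma integral_comp_mul_exp {X X' : Type*} [MeasurableSpace X] [MeasurableSpace X']
    {m : Measure X} [IsProbabilityMeasure m] {m' : Measure X'} {π : X' → X}
    (hπ : Measurable π) {g : X' → ℝ} (hg : Measurable g) {κ : Kernel X ℝ} [IsMarkovKernel κ]
    (hκ : m ⊗ₘ κ = m'.map fun a => (π a, g a)) {k : X → ℂ} (hk : Measurable k)
    (hk1 : ∀ x, ‖k x‖ ≤ 1) (s : ℝ) :
    ∫ a, k (π a) * Complex.exp (s * g a * Complex.I) ∂m' = ∫ x, k x * charFun (κ x) s ∂m := by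
  have hmeas : Measurable fun p : X × ℝ => k p.1 * Complex.exp (s * p.2 * Complex.I) :=
    (hk.comp measurable_fst).mul (measurable_exp_mul_mul_I measurable_snd s)
  have h1 : ∀ x, k x * charFun (κ x) s =
      ∫ t, (fun p : X × ℝ => k p.1 * Complex.exp (s * p.2 * Complex.I)) (x, t) ∂κ x := by
    intro x
    rw [charFun_apply_real, ← integral_const_mul]
  have hint : Integrable (fun p : X × ℝ => k p.1 * Complex.exp (s * p.2 * Complex.I))
      (m ⊗ₘ κ) := by
    refine Integrable.of_bound hmeas.aestronglyMeasurable 1 (Eventually.of_forall fun p => ?_)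
    rw [norm_mul, norm_exp_mul_mul_I, mul_one]
    exact hk1 _
  rw [integral_congr_ae (Eventually.of_forall h1), ← Measure.integral_compProd hint, hκ,
    integral_map (hπ.prodMk hg).aemeasurable hmeas.aestronglyMeasurable]

/-- If `exp(isg)` is twisted-invariant under `T'` with a twist coming from the factor, then its
conditional expectations given the factor satisfy the same relation over `T`. -/
lemma ae_charFun_eq_mul_comp {X X' : Type*} [MeasurableSpace X] [MeasurableSpace X']
    {m : Measure X} [IsProbabilityMeasure m] {m' : Measure X'}
    {T : X → X} (hT : MeasurePreserving T m m) {T' : X' → X'} (hT' : MeasurePreserving T' m' m')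
    {π : X' → X} (hπ : Measurable π) (hcomm : T ∘ π = π ∘ T')
    {g : X' → ℝ} (hg : Measurable g) {κ : Kernel X ℝ} [IsMarkovKernel κ]
    (hκ : m ⊗ₘ κ = m'.map fun a => (π a, g a)) {f : X → ℝ} (hf : Measurable f) {s : ℝ}
    (hgs : ∀ᵐ a ∂m', Complex.exp (s * g a * Complex.I) =
      Complex.exp (s * f (π a) * Complex.I) * Complex.exp (s * g (T' a) * Complex.I)) :
    ∀ᵐ x ∂m, charFun (κ x) s = Complex.exp (s * f x * Complex.I) * charFun (κ (T x)) s := by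
  have hconj : Measurable (conj : ℂ → ℂ) := Complex.continuous_conj.measurable
  have hc := measurable_exp_mul_mul_I hf s
  have hh := measurable_charFun_kernel κ s
  refine ae_eq_mul_comp_of_integral_conj_eq hT (h := fun x => charFun (κ x) s) hc
    (fun x => norm_exp_mul_mul_I _ _) hh (fun x => norm_charFun_le_one _) ?_
  rw [← integral_comp_mul_exp hπ hg hκ (k := fun x => conj
      (Complex.exp (s * f x * Complex.I) * charFun (κ (T x)) s))
      (hconj.comp (hc.mul (hh.comp hT.measurable))),
    ← integral_comp_mul_exp hπ hg hκ (k := fun x => conj (charFun (κ x) s)) (hconj.comp hh)]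
  -- The unimodular twist cancels its conjugate, leaving a function composed with `T'`, to which
  -- invariance of `m'` applies.
  · have h2 : ∀ᵐ a ∂m', conj (Complex.exp (s * f (π a) * Complex.I) * charFun (κ (T (π a))) s) *
        Complex.exp (s * g a * Complex.I) =
        (fun b => conj (charFun (κ (π b)) s) * Complex.exp (s * g b * Complex.I)) (T' a) := by
      filter_upwards [hgs] with a ha
      have h3 : T (π a) = π (T' a) := congrFun hcomm a
      have h4 : conj (Complex.exp (s * f (π a) * Complex.I)) *
          Complex.exp (s * f (π a) * Complex.I) = 1 := by
        rw [← Complex.normSq_eq_conj_mul_self, Complex.normSq_eq_norm_sq, norm_exp_mul_mul_I]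
        simp
      simp only [ha, h3, map_mul]
      linear_combination (conj (charFun (κ (π (T' a))) s) *
        Complex.exp (s * g (T' a) * Complex.I)) * h4
    refine (integral_congr_ae h2).trans ?_
    have hsm : AEStronglyMeasurable
        (fun b => conj (charFun (κ (π b)) s) * Complex.exp (s * g b * Complex.I))
        (m'.map T') :=
      ((hconj.comp (hh.comp hπ)).mul (measurable_exp_mul_mul_I hg s)).aestronglyMeasurable
    rw [← integral_map hT'.measurable.aemeasurable hsm, hT'.map_eq]
  · intro x
    simpa using norm_charFun_le_one (μ := κ x) s
  · intro x
    have := norm_exp_mul_mul_I s (f x)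
    simp only [RCLike.norm_conj, norm_mul, this, one_mul]
    exact norm_charFun_le_one s

/-! ### Conditional medians -/

/-- The smallest median of a measure on the line. -/
noncomputable def lowerMedian (μ : Measure ℝ) : ℝ := sInf {t | 2⁻¹ ≤ μ (Set.Iic t)}

/-- With `lowerMedian_set_bddBelow`, this makes the `sInf` a genuine infimum rather than a default
value. -/
lemma lowerMedian_set_nonempty (μ : Measure ℝ) [IsProbabilityMeasure μ] :
    {t | 2⁻¹ ≤ μ (Set.Iic t)}.Nonempty := by
  have h := tendsto_measure_Iic_atTop μ
  rw [measure_univ] at h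
  have := h.eventually (lt_mem_nhds (a := (2⁻¹ : ENNReal)) (by simp))
  obtain ⟨t, ht⟩ := this.exists
  exact ⟨t, ht.le⟩

lemma lowerMedian_set_bddBelow (μ : Measure ℝ) [IsProbabilityMeasure μ] :
    BddBelow {t | 2⁻¹ ≤ μ (Set.Iic t)} := by
  have h : Tendsto (fun x => μ (Set.Iic x)) atBot (𝓝 0) := by
    have := tendsto_measure_iInter_atBot (μ := μ) (s := fun x : ℝ => Set.Iic x)
      (fun x => measurableSet_Iic.nullMeasurableSet) (fun a b hab => Set.Iic_subset_Iic.2 hab)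
      ⟨0, measure_ne_top _ _⟩
    have he : ⋂ x : ℝ, Set.Iic x = ∅ := Set.eq_empty_of_forall_notMem fun y hy =>
      absurd (Set.mem_iInter.1 hy (y - 1)) (by simp)
    rwa [he, measure_empty] at this
  have h2 : (0 : ENNReal) < 2⁻¹ := by simp
  have := h.eventually (gt_mem_nhds h2)
  obtain ⟨t, ht⟩ := this.exists
  refine ⟨t, fun u hu => ?_⟩
  by_contra! hlt
  exact absurd (hu.trans (measure_mono (Set.Iic_subset_Iic.2 hlt.le))) (not_le.2 ht)

lemma measurable_lowerMedian {X : Type*} [MeasurableSpace X] (κ : Kernel X ℝ)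
    [IsMarkovKernel κ] : Measurable fun x => lowerMedian (κ x) := by
  refine measurable_of_Iio fun a => ?_
  have : (fun x => lowerMedian (κ x)) ⁻¹' Set.Iio a =
      ⋃ r : ℚ, ⋃ _ : (r : ℝ) < a, {x | 2⁻¹ ≤ κ x (Set.Iic (r : ℝ))} := by
    ext x
    simp only [Set.mem_preimage, Set.mem_Iio, Set.mem_iUnion, Set.mem_ofPred_eq, exists_prop]
    constructor
    · intro h
      obtain ⟨t, ht, hta⟩ := exists_lt_of_csInf_lt (lowerMedian_set_nonempty (κ x)) h
      obtain ⟨r, hr, hra⟩ := exists_rat_btwn hta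
      exact ⟨r, hra, le_trans ht (measure_mono (Set.Iic_subset_Iic.2 hr.le))⟩
    · rintro ⟨r, hra, hr⟩
      exact (csInf_le (lowerMedian_set_bddBelow (κ x)) hr).trans_lt hra
  rw [this]
  exact MeasurableSet.iUnion fun r => MeasurableSet.iUnion fun _ =>
    measurableSet_le measurable_const (κ.measurable_coe measurableSet_Iic)

/-- Translation is an order isomorphism of the line, so it commutes with infima. -/
lemma lowerMedian_map_add_const (μ : Measure ℝ) [IsProbabilityMeasure μ] (r : ℝ) :
    lowerMedian (μ.map (· + r)) = lowerMedian μ + r := by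
  have h : {t | 2⁻¹ ≤ (μ.map (· + r)) (Set.Iic t)} =
      OrderIso.addRight r '' {t | 2⁻¹ ≤ μ (Set.Iic t)} := by
    ext t
    rw [OrderIso.image_eq_preimage_symm]
    simp only [Set.mem_preimage, Set.mem_ofPred_eq]
    rw [Measure.map_apply (measurable_add_const r) measurableSet_Iic]
    simp [sub_eq_add_neg]
  unfold lowerMedian
  rw [h, ← OrderIso.map_csInf' _ (lowerMedian_set_nonempty μ) (lowerMedian_set_bddBelow μ)]
  rfl

/-! ### Atoms and countable fibres -/

/-- A probability measure on the line whose Fourier coefficients at the positive multiples of a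
frequency vanish has no atoms. -/
lemma measure_singleton_eq_zero_of_charFun {μ : Measure ℝ} [IsProbabilityMeasure μ] {s : ℝ}
    (h : ∀ n : ℕ, 0 < n → charFun μ (n * s) = 0) (a : ℝ) : μ {a} = 0 := by
  have hz : ∀ n : ℤ, n ≠ 0 → charFun μ (n * s) = 0 := by
    intro n hn
    rcases lt_or_gt_of_ne hn with h0 | h0
    · have h1 := h n.natAbs (Int.natAbs_pos.2 hn)
      have h2 : (n : ℝ) * s = -((n.natAbs : ℝ) * s) := by
        rw [Nat.cast_natAbs, abs_of_neg h0]; push_cast; ring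
      rw [h2, charFun_neg, h1, map_zero]
    · have h1 := h n.natAbs (Int.natAbs_pos.2 hn)
      rwa [Nat.cast_natAbs, abs_of_pos h0] at h1
  -- Centring at `a` makes every character equal to 1 there.
  let e : ℤ → ℝ → ℂ := fun n t => Complex.exp ((n * s : ℝ) * (t - a : ℝ) * Complex.I)
  have he : ∀ n, Integrable (e n) μ := fun n =>
    Integrable.of_bound (measurable_exp_mul_mul_I (measurable_id.sub_const a)
      _).aestronglyMeasurable 1 (Eventually.of_forall fun t => (norm_exp_mul_mul_I _ _).le)
  have hei : ∀ n, ∫ t, e n t ∂μ = if n = 0 then 1 else 0 := by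
    intro n
    split_ifs with hn
    · simp [e, hn]
    · have h1 : ∀ t, e n t = Complex.exp ((n * s : ℝ) * t * Complex.I) *
          Complex.exp (-((n * s : ℝ) * a * Complex.I)) := by
        intro t; simp only [e]; rw [← Complex.exp_add]; congr 1; push_cast; ring
      simp_rw [h1]
      rw [integral_mul_const, ← charFun_apply_real, hz n hn, zero_mul]
  -- The characters are orthonormal in L²(μ), so their sum `G` has squared norm `N`, whereas the
  -- point `a` alone contributes `N ^ 2 * μ.real {a}`.
  have hkey : ∀ N : ℕ, (N : ℝ) ^ 2 * μ.real {a} ≤ N := by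
    intro N
    let G : ℝ → ℂ := fun t => ∑ n ∈ Finset.range N, e n t
    have hG : ∀ t, ((‖G t‖ ^ 2 : ℝ) : ℂ) =
        ∑ n ∈ Finset.range N, ∑ k ∈ Finset.range N, e ((k : ℤ) - n) t := by
      intro t
      rw [← Complex.normSq_eq_norm_sq, Complex.normSq_eq_conj_mul_self, map_sum,
        Finset.sum_mul_sum]
      refine Finset.sum_congr rfl fun n _ => Finset.sum_congr rfl fun k _ => ?_
      simp only [e]
      rw [← Complex.exp_conj, ← Complex.exp_add]
      congr 1
      simp only [map_mul, Complex.conj_ofReal, Complex.conj_I]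
      push_cast; ring
    have hGi : ∫ t, ‖G t‖ ^ 2 ∂μ = N := by
      have : ((∫ t, ‖G t‖ ^ 2 ∂μ : ℝ) : ℂ) = N := by
        rw [← integral_complex_ofReal]
        simp_rw [hG]
        rw [integral_finsetSum _ fun n _ => integrable_finsetSum _ fun k _ => he _]
        have : ∀ n ∈ Finset.range N,
            ∫ t, ∑ k ∈ Finset.range N, e ((k : ℤ) - n) t ∂μ = 1 := by
          intro n hn
          rw [integral_finsetSum _ fun k _ => he _]
          simp_rw [hei, sub_eq_zero, Nat.cast_inj]
          rw [Finset.sum_ite_eq' , if_pos hn]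
        rw [Finset.sum_congr rfl this]; simp
      exact_mod_cast this
    have hGint : Integrable (fun t => ‖G t‖ ^ 2) μ := by
      have : Integrable (fun t => ((‖G t‖ ^ 2 : ℝ) : ℂ)) μ := by
        simp_rw [hG]
        exact integrable_finsetSum _ fun n _ => integrable_finsetSum _ fun k _ => he _
      exact this.re
    have hGa : G a = N := by simp [G, e]
    calc (N : ℝ) ^ 2 * μ.real {a} = ∫ t in {a}, ‖G t‖ ^ 2 ∂μ := by
          rw [integral_singleton, hGa]; simp [mul_comm]
      _ ≤ ∫ t, ‖G t‖ ^ 2 ∂μ := setIntegral_le_integral hGint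
          (Eventually.of_forall fun t => by positivity)
      _ = N := hGi
  rw [← measureReal_eq_zero_iff]
  by_contra hne
  have hpos : 0 < μ.real {a} := lt_of_le_of_ne measureReal_nonneg (Ne.symm hne)
  obtain ⟨N, hN⟩ := exists_nat_gt (μ.real {a})⁻¹
  have hN0 : (0 : ℝ) < N := (inv_pos.2 hpos).trans hN
  have h1 : 1 < N * μ.real {a} := by rwa [inv_lt_iff_one_lt_mul₀ hpos] at hN
  nlinarith [hkey N]

/-- Over a factor map with countable fibres, a disintegration of the joint law cannot be
almost surely atomless. -/
lemma not_ae_atomless_of_countable_fibres {X X' : Type*} [MeasurableSpace X]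
    [StandardBorelSpace X] [MeasurableSpace X'] [StandardBorelSpace X']
    {m : Measure X} [IsProbabilityMeasure m] {m' : Measure X'} [IsProbabilityMeasure m']
    {π : X' → X} (hπ : Measurable π) (hfib : ∀ x : X, (π ⁻¹' {x}).Countable)
    {g : X' → ℝ} (hg : Measurable g) {κ : Kernel X ℝ} [IsMarkovKernel κ]
    (hκ : m ⊗ₘ κ = m'.map fun a => (π a, g a)) :
    ¬ ∀ᵐ x ∂m, ∀ t, κ x {t} = 0 := by
  intro hat
  let := upgradeStandardBorel X
  obtain ⟨τ₀, hb₀, hp₀⟩ := StandardBorelSpace.polish (α := X')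
  have hφ : Measurable fun a => (π a, g a) := hπ.prodMk hg
  -- A finer Polish topology with the same Borel sets makes `(π, g)` continuous, so compact sets
  -- have compact, hence measurable, images.
  obtain ⟨τ, hτ, hcont, hpol⟩ := hφ.exists_continuous
  have hborel : @BorelSpace X' τ _ := by
    refine @BorelSpace.mk X' τ _ ?_
    rw [hb₀.measurable_eq]
    exact (borel_eq_borel_of_le hpol hp₀ hτ).symm
  obtain ⟨K, hK, hKpos⟩ : ∃ K : Set X', @IsCompact X' τ K ∧ 0 < m' K := by
    have h1 := MeasurableSet.univ.exists_isCompact_lt_add (μ := m') (measure_ne_top _ _)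
      (ε := 1) one_ne_zero
    obtain ⟨K, -, hK, hlt⟩ := h1
    refine ⟨K, hK, pos_iff_ne_zero.2 fun h0 => ?_⟩
    simp [h0] at hlt
  have hcomp : IsCompact ((fun a => (π a, g a)) '' K) :=
    @IsCompact.image X' _ τ _ K _ hK hcont
  have hmeas := hcomp.measurableSet
  have hle : m' K ≤ (m ⊗ₘ κ) ((fun a => (π a, g a)) '' K) := by
    rw [hκ, Measure.map_apply hφ hmeas]
    exact measure_mono (Set.subset_preimage_image _ _)
  refine absurd hle (not_le.2 ?_)
  rw [Measure.compProd_apply hmeas]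
  refine lt_of_eq_of_lt ?_ hKpos
  refine lintegral_eq_zero_of_ae_eq_zero ?_
  filter_upwards [hat] with x hx
  -- The slice over `x` lies in the image under `g` of the countable fibre.
  have hcount : (Prod.mk x ⁻¹' ((fun a => (π a, g a)) '' K)).Countable := by
    refine ((hfib x).image g).mono ?_
    rintro t ⟨a, -, ha⟩
    simp only [Prod.mk.injEq] at ha
    exact ⟨a, ha.1, ha.2⟩
  have : NullSingletonClass (κ x) := ⟨hx⟩
  exact hcount.measure_zero _

/-! ### Passing between the system and its factor -/

lemma IsErgCoboundary.congr_ae {X : Type*} [MeasurableSpace X] {m : Measure X} {T : X → X}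
    {f f' : X → ℝ} (h : f =ᵐ[m] f') (hf : IsErgCoboundary m T f) : IsErgCoboundary m T f' := by
  obtain ⟨g, hg, hfg⟩ := hf
  exact ⟨g, hg, by filter_upwards [h, hfg] with x h1 h2; rw [← h1, h2]⟩

lemma IsErgPeriodic.congr_ae {X : Type*} [MeasurableSpace X] {m : Measure X} {T : X → X}
    {f f' : X → ℝ} (h : f =ᵐ[m] f') (hf : IsErgPeriodic m T f) : IsErgPeriodic m T f' := by
  obtain ⟨ρ, g, l, q, hg, hl, hfg⟩ := hf
  exact ⟨ρ, g, l, q, hg, hl, by filter_upwards [h, hfg] with x h1 h2; rw [← h1, h2]⟩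

section Factor

variable {X X' : Type*} [MeasurableSpace X] [MeasurableSpace X']
  {m : Measure X} {m' : Measure X'} {T : X → X} {T' : X' → X'} {π : X' → X} {f : X → ℝ}

lemma IsErgCoboundary.comp_factor (hπ : MeasurePreserving π m' m) (hcomm : T ∘ π = π ∘ T')
    (hf : IsErgCoboundary m T f) : IsErgCoboundary m' T' (f ∘ π) := by
  obtain ⟨g, hg, hfg⟩ := hf
  refine ⟨g ∘ π, hg.comp hπ.measurable, ?_⟩
  filter_upwards [hπ.quasiMeasurePreserving.ae hfg] with a ha
  have := congrFun hcomm a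
  simp only [Function.comp] at this ⊢
  rw [ha, this]

lemma IsErgPeriodic.comp_factor (hπ : MeasurePreserving π m' m) (hcomm : T ∘ π = π ∘ T')
    (hf : IsErgPeriodic m T f) : IsErgPeriodic m' T' (f ∘ π) := by
  obtain ⟨ρ, g, l, q, hg, hl, hfg⟩ := hf
  refine ⟨ρ, g ∘ π, l, q ∘ π, hg.comp hπ.measurable, hl, ?_⟩
  filter_upwards [hπ.quasiMeasurePreserving.ae hfg] with a ha
  have := congrFun hcomm a
  simp only [Function.comp] at this ⊢
  rw [ha, this]

lemma compProd_condDistrib_of_measurePreserving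
    [IsProbabilityMeasure m'] (hπ : MeasurePreserving π m' m) {g : X' → ℝ} (hg : Measurable g) :
    m ⊗ₘ condDistrib g π m' = m'.map fun a => (π a, g a) := by
  conv_lhs => enter [1]; rw [← hπ.map_eq]
  exact compProd_map_condDistrib hg.aemeasurable

/-- A function whose exponential at some positive frequency is, up to a constant phase, a
multiplicative coboundary with non-zero transfer function is periodic. -/
lemma isErgPeriodic_of_exp_mul_eq (hT : Ergodic T m) {s ρ : ℝ} (hs : 0 < s) {h : X → ℂ}
    (hh : Measurable h) (hne : ¬ h =ᵐ[m] 0)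
    (heq : ∀ᵐ x ∂m, h x = Complex.exp (s * (f x - ρ : ℝ) * Complex.I) * h (T x)) :
    IsErgPeriodic m T f := by
  have hnorm : (fun x => ‖h x‖) ∘ T =ᵐ[m] fun x => ‖h x‖ := by
    filter_upwards [heq] with x hx
    rw [Function.comp, hx, norm_mul, norm_exp_mul_mul_I, one_mul]
  obtain ⟨c, hc⟩ :=
    hT.ae_eq_const_of_ae_eq_comp_ae hh.norm.aestronglyMeasurable hnorm
  have hc0 : c ≠ 0 := by
    rintro rfl
    refine hne ?_
    filter_upwards [hc] with x hx
    simpa using hx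
  have hnz : ∀ᵐ x ∂m, h x ≠ 0 := by
    filter_upwards [hc] with x hx
    rw [← norm_ne_zero_iff]
    simpa [hx] using hc0
  have hnzT := hT.toMeasurePreserving.quasiMeasurePreserving.ae hnz
  -- Comparing arguments modulo `2π` and dividing by `s` gives transfer function `arg h / s` and
  -- period `2π / s`.
  have hq : ∀ᵐ x ∂m, ∃ q : ℤ, f x = ρ + Complex.arg (h x) / s - Complex.arg (h (T x)) / s +
      2 * Real.pi / s * q := by
    filter_upwards [heq, hnorm, hnz, hnzT] with x hx hn h0 h0T
    simp only [Function.comp] at hn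
    have h1 : Complex.exp ((h x).arg * Complex.I) =
        Complex.exp (s * (f x - ρ : ℝ) * Complex.I + (h (T x)).arg * Complex.I) := by
      have hn0 : (‖h x‖ : ℂ) ≠ 0 := by simpa using h0
      refine mul_left_cancel₀ hn0 ?_
      rw [Complex.norm_mul_exp_arg_mul_I, Complex.exp_add, ← hn, mul_left_comm,
        Complex.norm_mul_exp_arg_mul_I, ← hx]
    obtain ⟨n, hn⟩ := Complex.exp_eq_exp_iff_exists_int.1 h1
    have h2 : (h x).arg = s * (f x - ρ) + (h (T x)).arg + n * (2 * Real.pi) := by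
      have h3 := congrArg Complex.im hn
      simpa using h3
    refine ⟨-n, ?_⟩
    rw [h2]
    field_simp
    push_cast
    ring
  classical
  refine ⟨ρ, fun x => Complex.arg (h x) / s, 2 * Real.pi / s,
    fun x => if hx : ∃ q : ℤ, f x = ρ + Complex.arg (h x) / s - Complex.arg (h (T x)) / s +
      2 * Real.pi / s * q then hx.choose else 0, hh.carg.div_const s, by positivity, ?_⟩
  filter_upwards [hq] with x hx
  rw [dif_pos hx]
  exact hx.choose_spec

variable [IsProbabilityMeasure m] [IsProbabilityMeasure m']

/-- Coboundaries descend to factors: take the conditional medians of the transfer function. -/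
lemma isErgCoboundary_of_comp_factor (hT : MeasurePreserving T m m)
    (hT' : MeasurePreserving T' m' m') (hπ : MeasurePreserving π m' m)
    (hcomm : T ∘ π = π ∘ T') (hf : Measurable f) (h : IsErgCoboundary m' T' (f ∘ π)) :
    IsErgCoboundary m T f := by
  obtain ⟨g, hg, hfg⟩ := h
  have hκ := compProd_condDistrib_of_measurePreserving hπ hg
  set κ := condDistrib g π m'
  refine ⟨fun x => lowerMedian (κ x), measurable_lowerMedian κ, ?_⟩
  -- Rational frequencies keep the exceptional sets countable in number; continuity of `charFun`
  -- recovers the rest.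
  have hall : ∀ᵐ x ∂m, ∀ s : ℚ, charFun (κ x) (s : ℝ) =
      Complex.exp ((s : ℝ) * f x * Complex.I) * charFun (κ (T x)) (s : ℝ) := by
    refine ae_all_iff.2 fun s =>
      ae_charFun_eq_mul_comp hT hT' hπ.measurable hcomm hg hκ hf ?_
    filter_upwards [hfg] with a ha
    rw [← Complex.exp_add]
    simp only [Function.comp] at ha
    rw [ha]
    congr 1; push_cast; ring
  filter_upwards [hall] with x hx
  have hcf : charFun (κ x) = charFun ((κ (T x)).map (· + f x)) := by
    refine Continuous.ext_on Rat.denseRange_cast continuous_charFun ?_ ?_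
    · have : IsProbabilityMeasure ((κ (T x)).map (· + f x)) :=
        Measure.isProbabilityMeasure_map (measurable_add_const _).aemeasurable
      exact continuous_charFun
    · rintro _ ⟨s, rfl⟩
      rw [hx s, charFun_map_add_const, mul_comm]
      simp
  have : IsProbabilityMeasure ((κ (T x)).map (· + f x)) :=
    Measure.isProbabilityMeasure_map (measurable_add_const _).aemeasurable
  rw [Measure.ext_of_charFun hcf, lowerMedian_map_add_const]
  ring

/-- Periodicity descends to factors with countable fibres. -/
lemma isErgPeriodic_of_comp_factor [StandardBorelSpace X] [StandardBorelSpace X']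
    (hT : Ergodic T m) (hT' : MeasurePreserving T' m' m') (hπ : MeasurePreserving π m' m)
    (hfib : ∀ x : X, (π ⁻¹' {x}).Countable) (hcomm : T ∘ π = π ∘ T') (hf : Measurable f)
    (h : IsErgPeriodic m' T' (f ∘ π)) : IsErgPeriodic m T f := by
  obtain ⟨ρ, g, l, q, hg, hl, hfg⟩ := h
  have hκ := compProd_condDistrib_of_measurePreserving hπ hg
  set κ := condDistrib g π m'
  by_contra hper
  refine not_ae_atomless_of_countable_fibres hπ.measurable hfib hg hκ ?_
  have hzero : ∀ᵐ x ∂m, ∀ n : ℕ, 0 < n → charFun (κ x) (n * (2 * Real.pi / l)) = 0 := by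
    refine ae_all_iff.2 fun n => ?_
    rcases Nat.eq_zero_or_pos n with hn | hn
    · simp [hn]
    by_contra hne
    -- A coefficient at `n * (2π / l)` that is not a.e. zero would make `f` periodic with period `l
    -- / n`.
    refine hper (isErgPeriodic_of_exp_mul_eq hT (s := n * (2 * Real.pi / l)) (ρ := ρ)
      (by positivity) (measurable_charFun_kernel κ _) (fun h0 => hne ?_)
      (ae_charFun_eq_mul_comp hT.toMeasurePreserving hT' hπ.measurable hcomm hg hκ
        (hf.sub_const ρ) ?_))
    · filter_upwards [h0] with x hx _ using hx
    · filter_upwards [hfg] with a ha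
      simp only [Function.comp] at ha
      rw [← Complex.exp_add, ha, Complex.exp_eq_exp_iff_exists_int]
      -- At this frequency the term `l * q a` contributes the phase `2π * n * q a`.
      refine ⟨-(n * q a), ?_⟩
      have hl' : (l : ℂ) ≠ 0 := by exact_mod_cast hl.ne'
      push_cast
      field_simp
      ring
  filter_upwards [hzero] with x hx
  exact measure_singleton_eq_zero_of_charFun hx

end Factor

theorem theorem1p6 {X X' : Type*}
    [MeasurableSpace X] [StandardBorelSpace X] [MeasurableSpace X']
    (m : Measure X) [IsProbabilityMeasure m] (m' : Measure X') [IsProbabilityMeasure m']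
    (T : X → X) (hT : Ergodic T m)
    (T' : X' → X') (hT' : MeasurePreserving T' m' m')
    (π : X' → X) (hπ : MeasurePreserving π m' m)
    (hfib : ∀ x : X, (π ⁻¹' {x}).Countable)
    (hcomm : T ∘ π = π ∘ T')
    (f : X → ℝ) (hf : AEMeasurable f m) :
    (IsErgCoboundary m T f ↔ IsErgCoboundary m' T' (f ∘ π)) ∧
    (IsErgAperiodic m' T' (f ∘ π) → IsErgAperiodic m T f) ∧
    (StandardBorelSpace X' → IsErgAperiodic m T f → IsErgAperiodic m' T' (f ∘ π)) := by
  have hfπ : f ∘ π =ᵐ[m'] hf.mk f ∘ π :=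
    hπ.quasiMeasurePreserving.ae_eq_comp hf.ae_eq_mk
  refine ⟨⟨fun h => h.comp_factor hπ hcomm, fun h => ?_⟩,
    fun h hper => h (hper.comp_factor hπ hcomm), fun _ h hper => h ?_⟩
  · exact (isErgCoboundary_of_comp_factor hT.toMeasurePreserving hT' hπ hcomm
      hf.measurable_mk (h.congr_ae hfπ)).congr_ae hf.ae_eq_mk.symm
  · exact (isErgPeriodic_of_comp_factor hT hT' hπ hfib hcomm
      hf.measurable_mk (hper.congr_ae hfπ)).congr_ae hf.ae_eq_mk.symm
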